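/- **Deterministic time-delay prediction theorem.** Let $N\in\mathbb N$, let $X\subset\mathbb R^N$ be an arbitrary set and let $T\colon X\to X$ be locally Lipschitz. Let $\mathrm{Lip}_{loc}(X)$ be the linear space of all locally Lipschitz functions $h\colon X\to\mathbb R$ (those which are Lipschitz on some neighbourhood in $X$ of each point of $X$). Fix a countable basis $U_1,U_2,\dots$ of the topology of $\mathbb R^N$ consisting of bounded sets and equip $\mathrm{Lip}_{loc}(X)$ with the metric $$d(g,h)=\sum_{n=1}^\infty 2^{-n}\min\{1,\|g-h\|_{1,U_n\cap X}\},\qquad \|f\|_{1,Y}=\sup_{x\in Y}|f(x)|+\sup_{x,y\in Y,\,x\ne y}\frac{|f(x)-f(y)|}{\|x-y\|}\in[0,\infty].$$ A Borel set $\mathcal S\subset V=\mathrm{Lip}_{loc}(X)$ is called prevalent if there is a Borel measure $\nu$ on $V$, positive and finite on some compact set, such that for every $v\in V$ one has $v+e\in\mathcal S$ for $\nu$-almost every $e\in V$; an arbitrary subset of $V$ is called prevalent if it contains a prevalent Borel set. For a bounded set $Y\subset\mathbb R^N$ let $\underline{\dim}_B Y=\liminf_{\delta\to0^+}\frac{\log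 N(Y,\delta)}{-\log\delta}$, where $N(Y,\delta)$ is the minimal number of balls of diameter at most $\delta$ covering $Y$; for an unbounded set, $\underline{\dim}_B$ is the supremum of the lower box-counting dimensions of its bounded subsets. For $h\colon X\to\mathbb R$ and $k\in\mathbb N$ let $\phi=\phi_{h,k}\colon X\to\mathbb R^k$, $\phi(x)=(h(x),h(Tx),\dots,h(T^{k-1}x))$, be the $k$-delay coordinate map. The function $h$ is called deterministically $k$-predictable if for every $y\in\phi(X)$ the map $\phi\circ T$ is constant on $\phi^{-1}(\{y\})$; equivalently, $\phi(x_1)=\phi(x_2)$ implies $\phi(Tx_1)=\phi(Tx_2)$ for all $x_1,x_2\in X$. Then the set of all $h\in\mathrm{Lip}_{loc}(X)$ with the following property is prevalent: for every $k\in\mathbb N$ with $k>2\,\underline{\dim}_B X$, the function $h$ is deterministically $k$-predictable, so that there is a (unique) map $S\colon\phi(X)\to\phi(X)$ with $S\circ\phi=\phi\circ T$; and if moreover $X$ is compact, then $S$ is continuous. -/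

import Mathlib

open Set Filter Topology MeasureTheory
open scoped ENNReal NNReal

noncomputable section

/-- A countable basis `U 0, U 1, …` of the standard topology of `ℝ^N` consisting of bounded sets. -/
structure BoundedBasis (N : ℕ) where
  U : ℕ → Set (EuclideanSpace ℝ (Fin N))
  isBasis : TopologicalSpace.IsTopologicalBasis (range U)
  isBounded : ∀ n, Bornology.IsBounded (U n)

/-- The linear space of locally Lipschitz functions `X → ℝ`. -/
def lipLocSubmodule {N : ℕ} (X : Set (EuclideanSpace ℝ (Fin N))) : Submodule ℝ (X → ℝ) where
  carrier := {h | LocallyLipschitz h}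
  add_mem' := by
    intro a b ha hb
    have h2 : LocallyLipschitz (fun p : ℝ × ℝ => p.1 + p.2) :=
      (LipschitzWith.prod_fst.add LipschitzWith.prod_snd).locallyLipschitz
    exact h2.comp (ha.prodMk hb)
  zero_mem' := LocallyLipschitz.const (0 : ℝ)
  smul_mem' := by
    intro c a ha
    exact (lipschitzWith_smul c).locallyLipschitz.comp ha

/-- The space `Lip_loc(X)`. It carries the metric `d_{1,X}` below, which is built from the basis
`𝓑`; this is why `𝓑` is a parameter of the type. -/
def LipLoc {N : ℕ} (X : Set (EuclideanSpace ℝ (Fin N))) (_𝓑 : BoundedBasis N) : Type :=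
  lipLocSubmodule X

namespace LipLoc

variable {N : ℕ} {X : Set (EuclideanSpace ℝ (Fin N))} {𝓑 : BoundedBasis N}

instance : AddCommGroup (LipLoc X 𝓑) := inferInstanceAs (AddCommGroup (lipLocSubmodule X))

instance : Module ℝ (LipLoc X 𝓑) := inferInstanceAs (Module ℝ (lipLocSubmodule X))

instance : CoeFun (LipLoc X 𝓑) (fun _ => X → ℝ) := ⟨fun h => h.1⟩

/-- The extended Lipschitz norm `‖h‖_{1, Y ∩ X} = sup |h(x)| + sup |h(x) - h(y)| / ‖x - y‖`, both
suprema being over the points of `Y ∩ X`; it may be infinite. -/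
def lipNormOn (Y : Set (EuclideanSpace ℝ (Fin N))) (h : X → ℝ) : ℝ≥0∞ :=
  (⨆ (x : X) (_ : (x : EuclideanSpace ℝ (Fin N)) ∈ Y), ‖h x‖ₑ) +
    ⨆ (x : X) (y : X) (_ : (x : EuclideanSpace ℝ (Fin N)) ∈ Y)
      (_ : (y : EuclideanSpace ℝ (Fin N)) ∈ Y) (_ : x ≠ y), ‖h x - h y‖ₑ / edist x y

/-- `d_{1,X}(g, h) = ∑_{n ≥ 1} 2^{-n} min {1, ‖g - h‖_{1, U_n ∩ X}}`
(the basis is indexed from `0` here). -/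
def eDist (g h : LipLoc X 𝓑) : ℝ≥0∞ :=
  ∑' n : ℕ, (2⁻¹ : ℝ≥0∞) ^ (n + 1) * min 1 (lipNormOn (𝓑.U n) (fun x => g x - h x))

theorem eDist_self (g : LipLoc X 𝓑) : eDist g g = 0 := by
  simp [eDist, lipNormOn]

theorem eDist_comm (g h : LipLoc X 𝓑) : eDist g h = eDist h g := by
  have key : ∀ n, lipNormOn (𝓑.U n) (fun x => g x - h x)
      = lipNormOn (𝓑.U n) (fun x => h x - g x) := by
    intro n
    have h1 : ∀ x, ‖g x - h x‖ₑ = ‖h x - g x‖ₑ := fun x => by rw [← enorm_neg, neg_sub]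
    have h2 : ∀ x y, ‖g x - h x - (g y - h y)‖ₑ = ‖h x - g x - (h y - g y)‖ₑ := fun x y => by
      rw [← enorm_neg]; congr 1; ring
    simp only [lipNormOn, h1, h2]
  simp only [eDist, key]

theorem lipNormOn_add_le (Y : Set (EuclideanSpace ℝ (Fin N))) (g h : X → ℝ) :
    lipNormOn Y (fun x => g x + h x) ≤ lipNormOn Y g + lipNormOn Y h := by
  unfold lipNormOn
  rw [add_add_add_comm]
  refine add_le_add ?_ ?_
  · refine iSup₂_le fun x hx => (enorm_add_le _ _).trans (add_le_add ?_ ?_)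
    · exact le_iSup₂ (f := fun (x : X) (_ : (x : EuclideanSpace ℝ (Fin N)) ∈ Y) => ‖g x‖ₑ) x hx
    · exact le_iSup₂ (f := fun (x : X) (_ : (x : EuclideanSpace ℝ (Fin N)) ∈ Y) => ‖h x‖ₑ) x hx
  · refine iSup₂_le fun x y => iSup₂_le fun hx hy => iSup_le fun hxy => ?_
    have h1 : ‖g x + h x - (g y + h y)‖ₑ ≤ ‖g x - g y‖ₑ + ‖h x - h y‖ₑ := by
      rw [add_sub_add_comm]; exact enorm_add_le _ _
    refine (ENNReal.div_le_div_right h1 _).trans ?_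
    rw [ENNReal.add_div]
    have aux : ∀ f : X → ℝ, ‖f x - f y‖ₑ / edist x y ≤
        ⨆ (x : X) (y : X) (_ : (x : EuclideanSpace ℝ (Fin N)) ∈ Y)
          (_ : (y : EuclideanSpace ℝ (Fin N)) ∈ Y) (_ : x ≠ y), ‖f x - f y‖ₑ / edist x y := by
      intro f
      refine le_iSup_of_le x (le_iSup_of_le y (le_iSup_of_le hx (le_iSup_of_le hy ?_)))
      exact le_iSup_of_le hxy le_rfl
    exact add_le_add (aux g) (aux h)

theorem eDist_triangle (f g h : LipLoc X 𝓑) : eDist f h ≤ eDist f g + eDist g h := by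
  unfold eDist
  rw [← ENNReal.tsum_add]
  refine ENNReal.tsum_le_tsum fun n => ?_
  rw [← mul_add]
  gcongr
  have h1 : lipNormOn (𝓑.U n) (fun x => f x - h x) ≤
      lipNormOn (𝓑.U n) (fun x => f x - g x) + lipNormOn (𝓑.U n) (fun x => g x - h x) := by
    have := lipNormOn_add_le (𝓑.U n) (fun x => f x - g x) (fun x => g x - h x)
    simpa using this
  refine (min_le_min_left 1 h1).trans ?_
  rcases le_total 1 (lipNormOn (𝓑.U n) (fun x => f x - g x)) with h2 | h2
  · rw [min_eq_left h2]; exact (min_le_left _ _).trans le_self_add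
  rcases le_total 1 (lipNormOn (𝓑.U n) (fun x => g x - h x)) with h3 | h3
  · rw [min_eq_left h3]; exact (min_le_left _ _).trans le_add_self
  rw [min_eq_right h2, min_eq_right h3]; exact min_le_right _ _

theorem eq_of_eDist_eq_zero (g h : LipLoc X 𝓑) (H : eDist g h = 0) : g = h := by
  refine Subtype.ext (funext fun x => ?_)
  obtain ⟨_, ⟨n, rfl⟩, hx, -⟩ := 𝓑.isBasis.exists_subset_of_mem_open
    (mem_univ (x : EuclideanSpace ℝ (Fin N))) isOpen_univ
  have h1 := ENNReal.tsum_eq_zero.1 H n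
  have h2 : lipNormOn (𝓑.U n) (fun x => g x - h x) = 0 := by
    rcases mul_eq_zero.1 h1 with h3 | h3
    · simp at h3
    · rcases min_choice (1 : ℝ≥0∞) (lipNormOn (𝓑.U n) (fun x => g x - h x)) with h4 | h4
      · rw [h4] at h3; simp at h3
      · rwa [h4] at h3
  have h3 : ‖g x - h x‖ₑ ≤ 0 := by
    rw [← h2]
    refine le_trans ?_ le_self_add
    exact le_iSup₂ (f := fun (x : X) (_ : (x : EuclideanSpace ℝ (Fin N)) ∈ 𝓑.U n) =>
      ‖g x - h x‖ₑ) x hx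
  have h4 : g x - h x = 0 := by simpa using h3
  exact sub_eq_zero.1 h4

theorem eDist_ne_top (g h : LipLoc X 𝓑) : eDist g h ≠ ⊤ := by
  have h1 : eDist g h ≤ ∑' n : ℕ, (2⁻¹ : ℝ≥0∞) ^ (n + 1) :=
    ENNReal.tsum_le_tsum fun n => mul_le_of_le_one_right' (min_le_left _ _)
  refine ne_top_of_le_ne_top ?_ h1
  rw [ENNReal.tsum_geometric_add_one]
  simp

/-- The metric `d_{1,X}` on `Lip_loc(X)`. -/
instance : MetricSpace (LipLoc X 𝓑) :=
  @EMetricSpace.toMetricSpace (LipLoc X 𝓑)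
    { edist := eDist
      edist_self := eDist_self
      edist_comm := eDist_comm
      edist_triangle := eDist_triangle
      eq_of_edist_eq_zero := fun {g h} H => eq_of_eDist_eq_zero g h H }
    eDist_ne_top

end LipLoc

/-- A set `S` is prevalent if it contains a Borel set `B` for which there is a Borel measure `ν`,
positive and finite on some compact set, such that for every `v` one has `v + e ∈ B` for
`ν`-almost every `e`. (A Borel set is prevalent in this sense if and only if it can itself be taken
for `B`, with the same `ν`.) -/
def IsPrevalent {V : Type*} [AddCommGroup V] [TopologicalSpace V] (S : Set V) : Prop :=
  ∃ B : Set V, B ⊆ S ∧ MeasurableSet[borel V] B ∧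
    ∃ ν : @Measure V (borel V),
      (∃ K : Set V, IsCompact K ∧ 0 < ν K ∧ ν K < ⊤) ∧ ∀ v : V, ν {e : V | v + e ∉ B} = 0

/-- The lower box-counting dimension of a bounded set,
`liminf_{δ → 0+} log N(X, δ) / (-log δ)`, where `N(X, δ)` is the minimal number of balls of
diameter at most `δ` (i.e. of radius `δ / 2`, with centres anywhere) that cover `X`. -/
def lowerBoxDimBounded {N : ℕ} (X : Set (EuclideanSpace ℝ (Fin N))) : EReal :=
  liminf (fun δ : ℝ≥0 =>
      ENNReal.log ((Metric.externalCoveringNumber (δ / 2) X : ℕ∞) : ℝ≥0∞) /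
        ((-Real.log (δ : ℝ) : ℝ) : EReal))
    (𝓝[>] (0 : ℝ≥0))

/-- The lower box-counting dimension of an arbitrary set: the supremum over its bounded subsets
(for a bounded set this is `lowerBoxDimBounded X`, by monotonicity). -/
def lowerBoxDim {N : ℕ} (X : Set (EuclideanSpace ℝ (Fin N))) : EReal :=
  ⨆ (Y : Set (EuclideanSpace ℝ (Fin N))) (_ : Y ⊆ X) (_ : Bornology.IsBounded Y),
    lowerBoxDimBounded Y

/-- The `k`-delay coordinate map `φ(x) = (h(x), h(Tx), …, h(T^{k-1}x))`. -/
def delayMap {X : Type*} (k : ℕ) (T : X → X) (h : X → ℝ) (x : X) : EuclideanSpace ℝ (Fin k) :=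
  WithLp.toLp 2 fun i => h (T^[i] x)

/-- `h` is deterministically `k`-predictable at `y`: `φ ∘ T` is constant on `φ⁻¹({y})`. -/
def IsDetPredictableAt {X : Type*} (k : ℕ) (T : X → X) (h : X → ℝ)
    (y : EuclideanSpace ℝ (Fin k)) : Prop :=
  ∀ x₁ ∈ delayMap k T h ⁻¹' {y}, ∀ x₂ ∈ delayMap k T h ⁻¹' {y},
    delayMap k T h (T x₁) = delayMap k T h (T x₂)

/-- `h` is deterministically `k`-predictable: it is so at every point of `φ(X)`. -/
def IsDetPredictable {X : Type*} (k : ℕ) (T : X → X) (h : X → ℝ) : Prop :=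
  ∀ y ∈ range (delayMap k T h), IsDetPredictableAt k T h y

/-- `S : φ(X) → φ(X)` is a prediction map: `S ∘ φ = φ ∘ T`, where `φ` is regarded as a map onto
`φ(X)`. Such a map is unique if it exists. -/
def IsPredictionMap {X : Type*} (k : ℕ) (T : X → X) (h : X → ℝ)
    (S : range (delayMap k T h) → range (delayMap k T h)) : Prop :=
  S ∘ rangeFactorization (delayMap k T h) = rangeFactorization (delayMap k T h) ∘ T

end

noncomputable section

/-! Predictability follows once the first `k` values of `h` along an orbit determine the next one
(`NextValueDetermined`). A pair `x, y` where this fails is exactly one where polynomial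
perturbations act freely: the differences of a polynomial along the first `k` points of the two
orbits fill `ℝ^k` (`orbitDiff_surjective`). Otherwise they satisfy a linear relation, which by
interpolation holds for every function; tested on `h ∘ T^[k - j]`, with `j` its last nonzero index,
it forces `h (T^[k] x) = h (T^[k] y)`. Hence no condition on periodic points is needed.

The probe measure is Lebesgue measure on the unit ball of coefficients. If the right inverse at a
pair is bounded by `l`, the coefficients for which the perturbed differences are at most `η` have
volume `O(η^k)` (`volume_slab_le`). A bounded piece of `X` covered by `n` balls of diameter `δ`
gives `n²` pairs of balls and total volume `O(n² δ^k)`, which tends to `0` along suitable scales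
because `k > 2 dim` (`exists_cover_of_dim_lt`). Countably many choices of basis sets, Lipschitz
constants and `l` exhaust all failures. -/

/-! ### Polynomial probes: interpolation and bounds. -/

/-- A coordinate function of `ℝ^N`, or the constant `1`. -/
def coordOrOne {N : ℕ} (o : Option (Fin N)) (x : EuclideanSpace ℝ (Fin N)) : ℝ :=
  o.elim 1 fun c => x c

/-- The monomial given by a word of length `n` in the coordinate functions and the constant `1`. -/
def wordMonomial {n N : ℕ} (w : Fin n → Option (Fin N)) (x : EuclideanSpace ℝ (Fin N)) : ℝ :=
  ∏ i, coordOrOne (w i) x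

/-- The polynomial function with coefficients `a` in the words of length `n`. -/
def wordPoly {n N : ℕ} (a : (Fin n → Option (Fin N)) → ℝ) (x : EuclideanSpace ℝ (Fin N)) : ℝ :=
  ∑ w, a w * wordMonomial w x

theorem contDiff_wordMonomial {n N : ℕ} (w : Fin n → Option (Fin N)) :
    ContDiff ℝ 1 (wordMonomial w) := by
  unfold wordMonomial
  refine contDiff_prod fun i _ => ?_
  cases h : w i with
  | none => exact contDiff_const
  | some c => exact (EuclideanSpace.proj (𝕜 := ℝ) c).contDiff

theorem contDiff_wordPoly {n N : ℕ} (a : (Fin n → Option (Fin N)) → ℝ) :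
    ContDiff ℝ 1 (wordPoly a) := by
  unfold wordPoly
  exact ContDiff.sum fun w _ => contDiff_const.mul (contDiff_wordMonomial w)

theorem wordPoly_add {n N : ℕ} (a b : (Fin n → Option (Fin N)) → ℝ)
    (x : EuclideanSpace ℝ (Fin N)) : wordPoly (a + b) x = wordPoly a x + wordPoly b x := by
  simp [wordPoly, add_mul, Finset.sum_add_distrib]

theorem wordPoly_sub {n N : ℕ} (a b : (Fin n → Option (Fin N)) → ℝ)
    (x : EuclideanSpace ℝ (Fin N)) : wordPoly (a - b) x = wordPoly a x - wordPoly b x := by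
  simp [wordPoly, sub_mul, Finset.sum_sub_distrib]

theorem wordPoly_smul {n N : ℕ} (c : ℝ) (a : (Fin n → Option (Fin N)) → ℝ)
    (x : EuclideanSpace ℝ (Fin N)) : wordPoly (c • a) x = c * wordPoly a x := by
  simp [wordPoly, Finset.mul_sum, mul_assoc]

/-- A product of `n` affine functions is a combination of words of length `n`. -/
theorem exists_wordPoly_eq_prod {n N : ℕ} (c : Fin n → Option (Fin N) → ℝ) :
    ∃ a : (Fin n → Option (Fin N)) → ℝ, ∀ x,
      wordPoly a x = ∏ i, ∑ o, c i o * coordOrOne o x := by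
  refine ⟨fun w => ∏ i, c i (w i), fun x => ?_⟩
  rw [Finset.prod_univ_sum]
  simp [wordPoly, wordMonomial, Finset.prod_mul_distrib]

/-- One coordinate in which the points differ suffices. For `p = z` the constant `1` is used, so
that this factor is harmless in a product over all points. -/
theorem exists_affine_separating {N : ℕ} (p z : EuclideanSpace ℝ (Fin N)) :
    ∃ c : Option (Fin N) → ℝ, ∑ o, c o * coordOrOne o z = 1 ∧
      (p ≠ z → ∑ o, c o * coordOrOne o p = 0) := by
  by_cases hpz : p = z
  · refine ⟨fun o => o.elim 1 fun _ => 0, ?_, fun h => absurd hpz h⟩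
    simp [Fintype.sum_option, coordOrOne]
  obtain ⟨i, hi⟩ : ∃ i, p i ≠ z i := by
    by_contra! h
    exact hpz (PiLp.ext h)
  have hi' : z i - p i ≠ 0 := sub_ne_zero.2 hi.symm
  refine ⟨fun o => o.elim (-p i / (z i - p i)) fun j => if j = i then 1 / (z i - p i) else 0,
    ?_, fun _ => ?_⟩
  · simp [Fintype.sum_option, coordOrOne]
    field_simp
    ring
  · simp [Fintype.sum_option, coordOrOne]
    field_simp
    ring

/-- The words of length `n` interpolate the indicator of a point among `n` points. -/
theorem exists_wordPoly_indicator {n N : ℕ} (p : Fin n → EuclideanSpace ℝ (Fin N))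
    (z : EuclideanSpace ℝ (Fin N)) :
    ∃ a : (Fin n → Option (Fin N)) → ℝ, wordPoly a z = 1 ∧
      ∀ i, p i ≠ z → wordPoly a (p i) = 0 := by
  choose c hc1 hc0 using fun i => exists_affine_separating (p i) z
  obtain ⟨a, ha⟩ := exists_wordPoly_eq_prod c
  refine ⟨a, ?_, fun i hi => ?_⟩
  · rw [ha]; exact Finset.prod_eq_one fun i _ => hc1 i
  · rw [ha]; exact Finset.prod_eq_zero (Finset.mem_univ i) (hc0 i hi)

/-- The words of length `n` interpolate arbitrary values at `n` points. -/
theorem exists_wordPoly_interpolate {n N : ℕ} (p : Fin n → EuclideanSpace ℝ (Fin N))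
    (g : EuclideanSpace ℝ (Fin N) → ℝ) :
    ∃ a : (Fin n → Option (Fin N)) → ℝ, ∀ i, wordPoly a (p i) = g (p i) := by
  classical
  choose a ha1 ha0 using fun z => exists_wordPoly_indicator p z
  have hsum : ∀ (s : Finset (EuclideanSpace ℝ (Fin N))) x,
      wordPoly (∑ z ∈ s, g z • a z) x = ∑ z ∈ s, g z * wordPoly (a z) x := by
    intro s x
    induction s using Finset.induction_on with
    | empty => simp [wordPoly]
    | insert z s hz ih => rw [Finset.sum_insert hz, Finset.sum_insert hz, wordPoly_add,
        wordPoly_smul, ih]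
  -- The sum runs over distinct points rather than indices, since orbit points may coincide.
  refine ⟨∑ z ∈ Finset.univ.image p, g z • a z, fun i => ?_⟩
  rw [hsum, Finset.sum_eq_single (p i)]
  · rw [ha1, mul_one]
  · intro z _ hz
    rw [ha0 z i hz.symm, mul_zero]
  · intro h
    exact absurd (Finset.mem_image_of_mem p (Finset.mem_univ i)) h

theorem exists_bound_wordMonomial {n N : ℕ} (w : Fin n → Option (Fin N))
    {Y : Set (EuclideanSpace ℝ (Fin N))} (hY : Bornology.IsBounded Y) :
    ∃ C : ℝ, 0 ≤ C ∧ (∀ x ∈ Y, |wordMonomial w x| ≤ C) ∧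
      ∀ x ∈ Y, ∀ y ∈ Y, |wordMonomial w x - wordMonomial w y| ≤ C * dist x y := by
  obtain ⟨R, hR⟩ := hY.subset_closedBall 0
  have hK := isCompact_closedBall (0 : EuclideanSpace ℝ (Fin N)) R
  obtain ⟨L, hL⟩ := (contDiff_wordMonomial w).locallyLipschitz.locallyLipschitzOn
    (s := Metric.closedBall 0 R) |>.exists_lipschitzOnWith_of_compact hK
  obtain ⟨C, hC⟩ := hK.exists_bound_of_continuousOn
    (contDiff_wordMonomial w).continuous.continuousOn
  refine ⟨max C L, le_max_of_le_right L.2, fun x hx => (hC x (hR hx)).trans (le_max_left _ _),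
    fun x hx y hy => ?_⟩
  have := hL.dist_le_mul x (hR hx) y (hR hy)
  rw [Real.dist_eq] at this
  exact this.trans (mul_le_mul_of_nonneg_right (le_max_right _ _) dist_nonneg)

/-- Linearity in `a` reduces this to single monomials; the factor `‖a‖` is what yields continuity of
`LipLoc.ofWordPoly` in the coefficients. -/
theorem exists_bound_wordPoly (n : ℕ) {N : ℕ}
    {Y : Set (EuclideanSpace ℝ (Fin N))} (hY : Bornology.IsBounded Y) :
    ∃ C : ℝ, 0 ≤ C ∧ ∀ a : (Fin n → Option (Fin N)) → ℝ,
      (∀ x ∈ Y, |wordPoly a x| ≤ C * ‖a‖) ∧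
      ∀ x ∈ Y, ∀ y ∈ Y, |wordPoly a x - wordPoly a y| ≤ C * ‖a‖ * dist x y := by
  choose C hC0 hC1 hC2 using fun w : Fin n → Option (Fin N) => exists_bound_wordMonomial w hY
  refine ⟨∑ w, C w, Finset.sum_nonneg fun w _ => hC0 w, fun a => ⟨fun x hx => ?_,
    fun x hx y hy => ?_⟩⟩
  · rw [Finset.sum_mul]
    refine (Finset.abs_sum_le_sum_abs _ _).trans (Finset.sum_le_sum fun w _ => ?_)
    rw [abs_mul, mul_comm]
    exact mul_le_mul (hC1 w x hx) (norm_le_pi_norm a w) (abs_nonneg _) (hC0 w)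
  · rw [wordPoly, wordPoly, ← Finset.sum_sub_distrib, Finset.sum_mul, Finset.sum_mul]
    refine (Finset.abs_sum_le_sum_abs _ _).trans (Finset.sum_le_sum fun w _ => ?_)
    rw [← mul_sub, abs_mul, mul_comm]
    calc _ ≤ (C w * dist x y) * ‖a‖ := mul_le_mul (hC2 w x hx y hy) (norm_le_pi_norm a w)
          (abs_nonneg _) (mul_nonneg (hC0 w) dist_nonneg)
      _ = _ := by ring

/-! ### Volume of slabs in coefficient space. -/

/-- The volume of the part of the unit ball on which an affine map, whose linear part `D` has the
right inverse `A`, takes values in a small cube. -/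
theorem volume_slab_le {ι κ : Type*} [Fintype ι] [Fintype κ] (D : (ι → ℝ) →ₗ[ℝ] (κ → ℝ))
    (A : (κ → ℝ) →ₗ[ℝ] (ι → ℝ)) (hDA : D ∘ₗ A = LinearMap.id) {l : ℝ}
    (hA : ∀ t ∈ Icc (0 : κ → ℝ) 1, ‖A t‖ ≤ l) (b : κ → ℝ) {η : ℝ} (hη : 0 ≤ η) :
    volume {a : ι → ℝ | a ∈ Metric.closedBall 0 1 ∧ ‖b + D a‖ ≤ η} ≤
      volume (Metric.closedBall (0 : ι → ℝ) (1 + l)) *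
        ENNReal.ofReal ((2 * η) ^ Fintype.card κ) := by
  set S := {a : ι → ℝ | a ∈ Metric.closedBall 0 1 ∧ ‖b + D a‖ ≤ η} with hS
  have hDc : Continuous D := D.continuous_of_finiteDimensional
  have hAc : Continuous A := A.continuous_of_finiteDimensional
  have hSm : MeasurableSet S :=
    (Metric.isClosed_closedBall.inter
      (isClosed_le (continuous_const.add hDc).norm continuous_const)).measurableSet
  have hcube : volume (Icc (0 : κ → ℝ) 1) = 1 := by simp [Real.volume_Icc_pi]
  have hmeas : MeasurableSet {p : (κ → ℝ) × (ι → ℝ) | p.2 + A p.1 ∈ S} :=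
    (continuous_snd.add (hAc.comp continuous_fst)).measurable hSm
  -- Since `D (A t) = t`, the condition `a + A t ∈ S` confines `t` to a cube of side `2 * η` centred
  -- at `-(b + D a)`, and `a` to the ball of radius `1 + l`.
  have hslice : ∀ a, volume {t ∈ Icc (0 : κ → ℝ) 1 | a + A t ∈ S} ≤
      (Metric.closedBall (0 : ι → ℝ) (1 + l)).indicator
        (fun _ => ENNReal.ofReal ((2 * η) ^ Fintype.card κ)) a := by
    intro a
    by_cases ha : a ∈ Metric.closedBall (0 : ι → ℝ) (1 + l)
    · rw [indicator_of_mem ha, ← Real.volume_pi_closedBall (-(b + D a)) hη]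
      refine measure_mono fun t ht => ?_
      have h1 := ht.2.2
      have h2 : D (A t) = t := LinearMap.congr_fun hDA t
      rw [map_add, h2] at h1
      rw [mem_closedBall_iff_norm, sub_neg_eq_add]
      rwa [add_comm t, add_assoc]
    · rw [indicator_of_notMem ha, nonpos_iff_eq_zero]
      convert measure_empty (μ := volume)
      refine eq_empty_of_forall_notMem fun t ht => ha ?_
      have h1 : ‖a + A t‖ ≤ 1 := mem_closedBall_zero_iff.1 ht.2.1
      have h2 := norm_sub_le (a + A t) (A t)
      rw [add_sub_cancel_right] at h2
      exact mem_closedBall_zero_iff.2 (by linarith [hA t ht.1])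
  -- Average the volume of `S` over its translates by `A t`, with `t` in the unit cube, and exchange
  -- the integrals; no determinant is needed.
  calc volume S = ∫⁻ t in Icc (0 : κ → ℝ) 1, volume S := by
        rw [setLIntegral_const, hcube, mul_one]
    _ = ∫⁻ t in Icc (0 : κ → ℝ) 1, volume {a | a + A t ∈ S} := by
        refine lintegral_congr fun t => ?_
        exact (measure_preimage_add_right volume (A t) S).symm
    _ = ((volume.restrict (Icc (0 : κ → ℝ) 1)).prod volume)
          {p : (κ → ℝ) × (ι → ℝ) | p.2 + A p.1 ∈ S} := (Measure.prod_apply hmeas).symm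
    _ = ∫⁻ a, (volume.restrict (Icc (0 : κ → ℝ) 1)) {t | a + A t ∈ S} :=
        Measure.prod_apply_symm hmeas
    _ ≤ ∫⁻ a, (Metric.closedBall (0 : ι → ℝ) (1 + l)).indicator
          (fun _ => ENNReal.ofReal ((2 * η) ^ Fintype.card κ)) a := by
        refine lintegral_mono fun a => ?_
        refine le_trans (le_of_eq ?_) (hslice a)
        have hm : MeasurableSet {t | a + A t ∈ S} :=
          (continuous_const.add hAc).measurable hSm
        rw [Measure.restrict_apply hm]
        congr 1
        ext t
        exact and_comm
    _ = _ := by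
        rw [lintegral_indicator Metric.isClosed_closedBall.measurableSet, setLIntegral_const,
          mul_comm]

/-! ### Economical covers at small scales. -/

theorem card_lt_of_log_div_lt {n : ℝ≥0∞} {δ s : ℝ} (hδ : 0 < δ) (hδ1 : δ < 1)
    (h : ENNReal.log n / ((-Real.log δ : ℝ) : EReal) < s) :
    n ≤ ENNReal.ofReal (δ ^ (-s)) := by
  have hlog : 0 < -Real.log δ := neg_pos.2 (Real.log_neg hδ hδ1)
  have h1 : ENNReal.log n < (s : EReal) * ((-Real.log δ : ℝ) : EReal) :=
    (EReal.div_lt_iff (EReal.coe_pos.2 hlog) (EReal.coe_ne_top _)).1 h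
  rw [← ENNReal.log_le_log_iff, ENNReal.log_ofReal_of_pos (Real.rpow_pos_of_pos hδ _),
    Real.log_rpow hδ]
  refine h1.le.trans (le_of_eq ?_)
  rw [← EReal.coe_mul]
  congr 1
  ring

/-- If `k > 2 dim Z`, then `Z` has covers by balls of arbitrarily small diameter `δ` whose number
`n` satisfies `n² δ^k < ε`. -/
theorem exists_cover_of_dim_lt {N k : ℕ} {Z : Set (EuclideanSpace ℝ (Fin N))}
    (h : 2 * lowerBoxDimBounded Z < (k : EReal)) {ε : ℝ} (hε : 0 < ε) :
    ∃ (δ : ℝ) (C : Finset (EuclideanSpace ℝ (Fin N))), 0 < δ ∧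
      (C.card : ℝ) ^ 2 * δ ^ k ≤ ε ∧ ∀ x ∈ Z, ∃ c ∈ C, dist x c ≤ δ / 2 := by
  have h' : lowerBoxDimBounded Z < ((k / 2 : ℝ) : EReal) := by
    by_contra! hcon
    refine absurd h (not_lt.2 ?_)
    calc (k : EReal) = 2 * ((k / 2 : ℝ) : EReal) := by
          rw [show (2 : EReal) = ((2 : ℝ) : EReal) from rfl, ← EReal.coe_mul]
          rw [mul_div_cancel₀ (k : ℝ) two_ne_zero]
          rfl
      _ ≤ _ := mul_le_mul_of_nonneg_left hcon (by norm_num)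
  obtain ⟨s, hs1, hs2⟩ := EReal.lt_iff_exists_real_btwn.1 h'
  have hs : 0 < (k : ℝ) - 2 * s := by
    have : s < (k : ℝ) / 2 := EReal.coe_lt_coe_iff.1 hs2
    linarith
  -- A lower limit controls only some arbitrarily small `δ`. At these the covering number is at most
  -- `δ ^ (-s)`, so `n² δ^k ≤ δ^(k - 2s)`, a positive power of `δ`.
  have hfreq := frequently_lt_of_liminf_lt (by isBoundedDefault) hs1
  have hcoe : Tendsto (fun δ : ℝ≥0 => (δ : ℝ)) (𝓝[>] 0) (𝓝 0) := by
    have : Tendsto (fun δ : ℝ≥0 => (δ : ℝ)) (𝓝 0) (𝓝 ((0 : ℝ≥0) : ℝ)) :=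
      NNReal.continuous_coe.tendsto 0
    exact this.mono_left nhdsWithin_le_nhds
  have hpow : Tendsto (fun δ : ℝ≥0 => (δ : ℝ) ^ ((k : ℝ) - 2 * s)) (𝓝[>] 0) (𝓝 0) := by
    have := hcoe.rpow_const (p := (k : ℝ) - 2 * s) (Or.inr hs.le)
    rwa [Real.zero_rpow hs.ne'] at this
  obtain ⟨δ, hδs, ⟨hδε, hδ1⟩, hδ0⟩ := (hfreq.and_eventually
    (((hpow.eventually (gt_mem_nhds hε)).and (hcoe.eventually (gt_mem_nhds one_pos))).and
      self_mem_nhdsWithin)).exists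
  have hδ0' : (0 : ℝ) < δ := NNReal.coe_pos.2 hδ0
  have hcard := card_lt_of_log_div_lt hδ0' hδ1 hδs
  have hne : Metric.externalCoveringNumber (δ / 2) Z ≠ ⊤ := by
    intro htop
    rw [htop] at hcard
    simp at hcard
  obtain ⟨C, hC, hCe⟩ : ∃ C, Metric.IsCover (δ / 2) Z C ∧
      C.encard = Metric.externalCoveringNumber (δ / 2) Z := by
    have : Nonempty {C // Metric.IsCover (δ / 2) Z C} := ⟨⟨Z, Metric.IsCover.refl _ _⟩⟩
    obtain ⟨⟨C, hC⟩, hCe⟩ := ENat.exists_eq_iInf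
      (fun C : {C // Metric.IsCover (δ / 2) Z C} => C.1.encard)
    refine ⟨C, hC, hCe.trans ?_⟩
    rw [Metric.externalCoveringNumber, iInf_subtype]
  have hfin : C.Finite := encard_ne_top_iff.1 (hCe ▸ hne)
  refine ⟨δ, hfin.toFinset, hδ0', ?_, fun x hx => ?_⟩
  · rw [← hCe, hfin.encard_eq_coe_toFinset_card] at hcard
    have hc : (hfin.toFinset.card : ℝ) ≤ (δ : ℝ) ^ (-s) := by
      refine (ENNReal.ofReal_le_ofReal_iff (Real.rpow_nonneg δ.2 (-s))).1 ?_
      rw [ENNReal.ofReal_natCast]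
      exact_mod_cast hcard
    calc (hfin.toFinset.card : ℝ) ^ 2 * (δ : ℝ) ^ k
        ≤ ((δ : ℝ) ^ (-s)) ^ 2 * (δ : ℝ) ^ k := by gcongr
      _ = (δ : ℝ) ^ ((k : ℝ) - 2 * s) := by
        rw [← Real.rpow_natCast, ← Real.rpow_natCast, ← Real.rpow_mul hδ0'.le,
          ← Real.rpow_add hδ0']
        congr 1
        push_cast
        ring
      _ ≤ ε := hδε.le
  · obtain ⟨c, hc, hxc⟩ := hC hx
    refine ⟨c, hfin.mem_toFinset.2 hc, ?_⟩
    have h1 : edist x c ≤ ((δ / 2 : ℝ≥0) : ℝ≥0∞) := hxc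
    rw [edist_le_coe, ← NNReal.coe_le_coe, coe_nndist] at h1
    simpa using h1

/-! ### Evaluation, translation and the probe map in `LipLoc`. -/

namespace LipLoc

variable {N : ℕ} {X : Set (EuclideanSpace ℝ (Fin N))} {𝓑 : BoundedBasis N}

theorem edist_def (g h : LipLoc X 𝓑) : edist g h = eDist g h := rfl

theorem locallyLipschitz (h : LipLoc X 𝓑) : LocallyLipschitz h := h.2

theorem add_apply (g h : LipLoc X 𝓑) (x : X) : (g + h) x = g x + h x := rfl

/-- Some basis set contains `x`, and the single term of the metric for that set already controls the
value at `x`. -/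
theorem continuous_eval (x : X) : Continuous fun h : LipLoc X 𝓑 => h x := by
  obtain ⟨_, ⟨n, rfl⟩, hx, -⟩ := 𝓑.isBasis.exists_subset_of_mem_open
    (mem_univ (x : EuclideanSpace ℝ (Fin N))) isOpen_univ
  refine continuous_iff_continuousAt.2 fun h => EMetric.tendsto_nhds.2 fun ε hε => ?_
  set c : ℝ≥0∞ := (2⁻¹ : ℝ≥0∞) ^ (n + 1) with hc
  have hc0 : c ≠ 0 := pow_ne_zero _ (by simp)
  have hctop : c ≠ ⊤ := ENNReal.pow_ne_top (by simp)
  have hpos : 0 < c * min 1 ε := ENNReal.mul_pos hc0 (lt_min one_pos hε).ne'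
  filter_upwards [Metric.eball_mem_nhds h hpos] with g hg
  have h1 : c * min 1 (lipNormOn (𝓑.U n) (fun x => g x - h x)) < c * min 1 ε :=
    lt_of_le_of_lt (ENNReal.le_tsum n) hg
  have h2 := (ENNReal.mul_lt_mul_iff_right hc0 hctop).1 h1
  have h3 : lipNormOn (𝓑.U n) (fun x => g x - h x) < ε := by
    rcases lt_or_ge (lipNormOn (𝓑.U n) (fun x => g x - h x)) 1 with h4 | h4
    · rw [min_eq_right h4.le] at h2
      exact h2.trans_le (min_le_right _ _)
    · rw [min_eq_left h4] at h2
      exact absurd (min_le_left 1 ε) (not_le.2 h2)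
  refine lt_of_le_of_lt ?_ h3
  rw [edist_eq_enorm_sub]
  refine le_trans ?_ le_self_add
  exact le_iSup₂ (f := fun (x : X) (_ : (x : EuclideanSpace ℝ (Fin N)) ∈ 𝓑.U n) =>
    ‖g x - h x‖ₑ) x hx

theorem continuous_const_add (v : LipLoc X 𝓑) : Continuous fun e : LipLoc X 𝓑 => v + e := by
  refine Isometry.continuous fun g h => ?_
  simp only [edist_def, eDist, add_apply, add_sub_add_left_eq_sub]

/-- A polynomial function, as a locally Lipschitz function on `X`. -/
def ofWordPoly (X : Set (EuclideanSpace ℝ (Fin N))) (𝓑 : BoundedBasis N) {n : ℕ}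
    (a : (Fin n → Option (Fin N)) → ℝ) : LipLoc X 𝓑 :=
  ⟨fun x => wordPoly a x,
    (contDiff_wordPoly a).locallyLipschitz.comp (LipschitzWith.subtype_val X).locallyLipschitz⟩

theorem ofWordPoly_apply {n : ℕ} (a : (Fin n → Option (Fin N)) → ℝ) (x : X) :
    ofWordPoly X 𝓑 a x = wordPoly a x := rfl

theorem lipNormOn_le {Y : Set (EuclideanSpace ℝ (Fin N))} {f : X → ℝ} {C : ℝ}
    (h1 : ∀ x : X, (x : EuclideanSpace ℝ (Fin N)) ∈ Y → |f x| ≤ C)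
    (h2 : ∀ x y : X, (x : EuclideanSpace ℝ (Fin N)) ∈ Y → (y : EuclideanSpace ℝ (Fin N)) ∈ Y →
      |f x - f y| ≤ C * dist x y) :
    lipNormOn Y f ≤ ENNReal.ofReal (2 * C) := by
  by_cases hC : 0 ≤ C
  · rw [two_mul, ENNReal.ofReal_add hC hC]
    refine add_le_add (iSup₂_le fun x hx => ?_)
      (iSup₂_le fun x y => iSup₂_le fun hx hy => iSup_le fun hxy => ?_)
    · rw [Real.enorm_eq_ofReal_abs]
      exact ENNReal.ofReal_le_ofReal (h1 x hx)
    · refine ENNReal.div_le_of_le_mul ?_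
      rw [Real.enorm_eq_ofReal_abs, edist_dist, ← ENNReal.ofReal_mul hC]
      exact ENNReal.ofReal_le_ofReal (h2 x y hx hy)
  · have hY : ∀ x : X, (x : EuclideanSpace ℝ (Fin N)) ∉ Y := fun x hx =>
      hC ((abs_nonneg _).trans (h1 x hx))
    simp [lipNormOn, hY]

/-- The constants `C m` need not be bounded in `m`, so there is no uniform Lipschitz estimate. The
truncation at `1` gives a summable majorant, and dominated convergence for counting measure applies
termwise. -/
theorem continuous_ofWordPoly (n : ℕ) :
    Continuous fun a : (Fin n → Option (Fin N)) → ℝ => ofWordPoly X 𝓑 a := by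
  choose C hC0 hC using fun m => exists_bound_wordPoly n (𝓑.isBounded m)
  refine continuous_iff_continuousAt.2 fun b => tendsto_iff_edist_tendsto_0.2 ?_
  set F : ((Fin n → Option (Fin N)) → ℝ) → ℕ → ℝ≥0∞ := fun a m =>
    (2⁻¹ : ℝ≥0∞) ^ (m + 1) * min 1 (ENNReal.ofReal (2 * (C m * ‖a - b‖))) with hF
  have hle : ∀ a, edist (ofWordPoly X 𝓑 a) (ofWordPoly X 𝓑 b) ≤ ∫⁻ m, F a m ∂Measure.count := by
    intro a
    rw [lintegral_count, edist_def, eDist]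
    refine ENNReal.tsum_le_tsum fun m => mul_le_mul_right (min_le_min_left 1 ?_) _
    simp only [ofWordPoly_apply, ← wordPoly_sub]
    exact lipNormOn_le (fun x hx => (hC m (a - b)).1 x hx)
      (fun x y hx hy => (hC m (a - b)).2 x hx y hy)
  have hlim : Tendsto (fun a => ∫⁻ m, F a m ∂Measure.count) (𝓝 b)
      (𝓝 (∫⁻ _, 0 ∂(Measure.count : Measure ℕ))) := by
    refine tendsto_lintegral_filter_of_dominated_convergence
      (fun m => (2⁻¹ : ℝ≥0∞) ^ (m + 1)) (Eventually.of_forall fun a => measurable_of_countable _)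
      (Eventually.of_forall fun a => Eventually.of_forall fun m =>
        mul_le_of_le_one_right' (min_le_left _ _)) ?_ (Eventually.of_forall fun m => ?_)
    · rw [lintegral_count, ENNReal.tsum_geometric_add_one]
      simp
    · have h1 : Tendsto (fun a => ENNReal.ofReal (2 * (C m * ‖a - b‖))) (𝓝 b) (𝓝 0) := by
        have : Continuous fun a => ENNReal.ofReal (2 * (C m * ‖a - b‖)) :=
          ENNReal.continuous_ofReal.comp (by fun_prop)
        simpa using this.tendsto b
      have h2 : Tendsto (fun a => min 1 (ENNReal.ofReal (2 * (C m * ‖a - b‖)))) (𝓝 b) (𝓝 0) :=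
        tendsto_of_tendsto_of_tendsto_of_le_of_le tendsto_const_nhds h1 (fun _ => zero_le)
          fun _ => min_le_right _ _
      have h3 := ENNReal.Tendsto.const_mul (a := (2⁻¹ : ℝ≥0∞) ^ (m + 1)) h2
        (Or.inr (ENNReal.pow_ne_top (by simp)))
      rwa [mul_zero] at h3
  rw [lintegral_zero] at hlim
  exact tendsto_of_tendsto_of_tendsto_of_le_of_le tendsto_const_nhds hlim (fun _ => zero_le) hle

end LipLoc

/-! ### From determination of the next value to the prediction map. -/

theorem delayMap_eq_iff {X : Type*} {k : ℕ} {T : X → X} {h : X → ℝ} {x y : X} :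
    delayMap k T h x = delayMap k T h y ↔ ∀ i < k, h (T^[i] x) = h (T^[i] y) := by
  constructor
  · intro H i hi
    exact congrFun (congrArg WithLp.ofLp H) ⟨i, hi⟩
  · intro H
    exact congrArg (WithLp.toLp 2) (funext fun i => H i i.2)

/-- The first `k` values along the orbit of a point determine the next one. -/
def NextValueDetermined {X : Type*} (k : ℕ) (T : X → X) (h : X → ℝ) : Prop :=
  ∀ x y, (∀ i < k, h (T^[i] x) = h (T^[i] y)) → h (T^[k] x) = h (T^[k] y)

/-- Passing from `x, y` to `T x, T y` shifts all indices by one. Thus one exceptional set serves all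
larger `k`. -/
theorem NextValueDetermined.mono {X : Type*} {k l : ℕ} {T : X → X} {h : X → ℝ} (hkl : k ≤ l)
    (H : NextValueDetermined k T h) : NextValueDetermined l T h := by
  induction l, hkl using Nat.le_induction with
  | base => exact H
  | succ l _ ih => exact fun x y hxy => ih (T x) (T y) fun i hi => hxy (i + 1) (by omega)

theorem NextValueDetermined.isDetPredictable {X : Type*} {k : ℕ} {T : X → X} {h : X → ℝ}
    (H : NextValueDetermined k T h) : IsDetPredictable k T h := by
  rintro _ ⟨z, rfl⟩ x hx y hy
  have hxy := delayMap_eq_iff.1 (Eq.trans hx (Eq.symm hy))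
  refine delayMap_eq_iff.2 fun i hi => ?_
  simp only [← Function.iterate_succ_apply]
  rcases Nat.lt_or_ge (i + 1) k with h2 | h2
  · exact hxy _ h2
  · rw [Nat.succ_eq_add_one, show i + 1 = k by omega]
    exact H x y hxy

/-- On a compact space the delay map is closed, hence a quotient map onto its image, and `S`
inherits continuity from `φ ∘ T`. -/
theorem IsDetPredictable.exists_isPredictionMap {X : Type*} [TopologicalSpace X] {k : ℕ}
    {T : X → X} {h : X → ℝ} (H : IsDetPredictable k T h) (hT : Continuous T) (hh : Continuous h) :
    ∃ S : range (delayMap k T h) → range (delayMap k T h),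
      IsPredictionMap k T h S ∧ (CompactSpace X → Continuous S) := by
  set φ := rangeFactorization (delayMap k T h) with hφ
  have hsurj : Function.Surjective φ := rangeFactorization_surjective
  have hS : ∀ x, φ (T (Function.surjInv hsurj (φ x))) = φ (T x) := fun x =>
    Subtype.ext (H (φ x) (φ x).2 _ (congrArg Subtype.val (Function.surjInv_eq hsurj (φ x))) x rfl)
  refine ⟨fun y => φ (T (Function.surjInv hsurj y)), funext hS, fun _ => ?_⟩
  have hφc : Continuous φ := by
    refine Continuous.subtype_mk ?_ _
    exact (PiLp.continuous_toLp 2 _).comp (continuous_pi fun i => hh.comp (hT.iterate i))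
  refine (hφc.isClosedMap.isQuotientMap hφc hsurj).continuous_iff.2 ?_
  exact (hφc.comp hT).congr fun x => (hS x).symm

/-! ### Independent separation of two orbits. -/

/-- The differences of a polynomial function along the orbits of two points, as a linear function
of its coefficients. -/
def orbitDiff {N : ℕ} {X : Set (EuclideanSpace ℝ (Fin N))} (n k : ℕ) (T : X → X) (x y : X) :
    ((Fin n → Option (Fin N)) → ℝ) →ₗ[ℝ] (Fin k → ℝ) where
  toFun a i := wordPoly a (T^[i] x) - wordPoly a (T^[i] y)
  map_add' a b := funext fun i => by simp only [wordPoly_add, Pi.add_apply]; ring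
  map_smul' c a := funext fun i => by
    simp only [wordPoly_smul, Pi.smul_apply, smul_eq_mul, RingHom.id_apply]; ring

/-- The pairs of points whose orbits can be separated independently by polynomial functions, with a
bound on the coefficients. -/
def separablePairs {N : ℕ} {X : Set (EuclideanSpace ℝ (Fin N))} (n k : ℕ) (T : X → X) (l : ℝ) :
    Set (X × X) :=
  {p | ∃ A : (Fin k → ℝ) →ₗ[ℝ] ((Fin n → Option (Fin N)) → ℝ),
    orbitDiff n k T p.1 p.2 ∘ₗ A = LinearMap.id ∧ ∀ t ∈ Icc (0 : Fin k → ℝ) 1, ‖A t‖ ≤ l}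

/-- If some function agrees along the first `k` points of two orbits but not at the next points,
then polynomial functions take arbitrary differences along the first `k` points. -/
theorem orbitDiff_surjective {N : ℕ} {X : Set (EuclideanSpace ℝ (Fin N))} {k : ℕ} {T : X → X}
    {x y : X} {h : X → ℝ} (hxy : ∀ i < k, h (T^[i] x) = h (T^[i] y))
    (hne : h (T^[k] x) ≠ h (T^[k] y)) : Function.Surjective (orbitDiff (k + k) k T x y) := by
  rw [← LinearMap.range_eq_top]
  by_contra hr
  obtain ⟨f, hf0, hf⟩ := Submodule.exists_le_ker_of_lt_top _ (lt_top_iff_ne_top.2 hr)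
  set c : Fin k → ℝ := fun i => f (Pi.single i 1) with hc
  have hfc : ∀ v, f v = ∑ i, v i * c i := fun v => by
    conv_lhs => rw [pi_eq_sum_univ' v]
    simp [hc, Pi.single]
  -- A functional killing all polynomial differences kills those of every function on `X`, because
  -- only the `k + k` listed orbit points matter.
  have hg : ∀ g : X → ℝ, ∑ i : Fin k, (g (T^[i] x) - g (T^[i] y)) * c i = 0 := by
    intro g
    obtain ⟨a, ha⟩ := exists_wordPoly_interpolate
      (Fin.append (fun i : Fin k => ((T^[i] x : X) : EuclideanSpace ℝ (Fin N)))
        (fun i : Fin k => ((T^[i] y : X) : EuclideanSpace ℝ (Fin N))))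
      (Function.extend Subtype.val g 0)
    have h1 : f (orbitDiff (k + k) k T x y a) = 0 := hf ⟨a, rfl⟩
    rw [hfc] at h1
    rw [← h1]
    refine Finset.sum_congr rfl fun i _ => ?_
    have hx := ha (Fin.castAdd k i)
    have hy := ha (Fin.natAdd k i)
    rw [Fin.append_left, Subtype.val_injective.extend_apply] at hx
    rw [Fin.append_right, Subtype.val_injective.extend_apply] at hy
    simp only [orbitDiff, LinearMap.coe_mk, AddHom.coe_mk, hx, hy]
  have hc0 : (Finset.univ.filter fun i => c i ≠ 0).Nonempty := by
    by_contra hcon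
    rw [Finset.not_nonempty_iff_eq_empty, Finset.filter_eq_empty_iff] at hcon
    refine hf0 (LinearMap.ext fun v => ?_)
    rw [hfc, LinearMap.zero_apply]
    exact Finset.sum_eq_zero fun i hi => by rw [not_not.1 (hcon hi), mul_zero]
  obtain ⟨j, hj, hmax⟩ := Finset.exists_max_image _ (fun i : Fin k => i) hc0
  have hcj : c j ≠ 0 := (Finset.mem_filter.1 hj).2
  -- Shifting by `k - j` moves the last index `j` to `k`, while smaller indices stay below `k`,
  -- where `h` agrees on both orbits; only the term `j` survives.
  have h1 := hg fun z => h (T^[k - j] z)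
  rw [Finset.sum_eq_single j] at h1
  · simp only [← Function.iterate_add_apply, Nat.sub_add_cancel j.2.le] at h1
    exact hne (sub_eq_zero.1 ((mul_eq_zero.1 h1).resolve_right hcj))
  · intro i _ hij
    rcases lt_or_gt_of_ne hij with h2 | h2
    · simp only [← Function.iterate_add_apply]
      rw [hxy (k - j + i) (by have := Fin.lt_def.1 h2; have := j.2; omega), sub_self, zero_mul]
    · have : c i = 0 := by
        by_contra hci
        exact absurd (hmax i (Finset.mem_filter.2 ⟨Finset.mem_univ i, hci⟩)) (not_le.2 h2)
      rw [this, mul_zero]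
  · exact fun h => absurd (Finset.mem_univ j) h

/-- Integer bounds `l` split the harmful pairs into countably many classes, each with a uniform
right inverse. -/
theorem exists_mem_separablePairs {N : ℕ} {X : Set (EuclideanSpace ℝ (Fin N))} {k : ℕ} {T : X → X}
    {x y : X} {h : X → ℝ} (hxy : ∀ i < k, h (T^[i] x) = h (T^[i] y))
    (hne : h (T^[k] x) ≠ h (T^[k] y)) : ∃ l : ℕ, (x, y) ∈ separablePairs (k + k) k T l := by
  obtain ⟨A, hA⟩ := LinearMap.exists_rightInverse_of_surjective _
    (LinearMap.range_eq_top.2 (orbitDiff_surjective hxy hne))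
  obtain ⟨C, hC⟩ := (isCompact_Icc : IsCompact (Icc (0 : Fin k → ℝ) 1)).exists_bound_of_continuousOn
    A.continuous_of_finiteDimensional.continuousOn
  obtain ⟨l, hl⟩ := exists_nat_ge C
  exact ⟨l, A, hA, fun t ht => (hC t ht).trans hl⟩

/-! ### The exceptional set and its measure. -/

/-- Functions that are `M`-Lipschitz along the orbits of the points of `U` and `V`, and agree
approximately along the orbits of a pair in `P ∩ (U × V)`. -/
def collisionSet {N : ℕ} {X : Set (EuclideanSpace ℝ (Fin N))} (𝓑 : BoundedBasis N) (k : ℕ)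
    (T : X → X) (U V : Set X) (M : ℝ) (P : Set (X × X)) : Set (LipLoc X 𝓑) :=
  {h | (∀ i < k, ∀ x ∈ U, ∀ y ∈ U, |h (T^[i] x) - h (T^[i] y)| ≤ M * dist x y) ∧
    (∀ i < k, ∀ x ∈ V, ∀ y ∈ V, |h (T^[i] x) - h (T^[i] y)| ≤ M * dist x y) ∧
    ∀ m : ℕ, ∃ p ∈ P, p.1 ∈ U ∧ p.2 ∈ V ∧
      ∀ i < k, |h (T^[i] p.1) - h (T^[i] p.2)| < 1 / ((m : ℝ) + 1)}

/-- Approximate agreement with tolerance `1 / (m + 1)` is an open condition even after a union over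
an arbitrary `P`. Demanding it for all `m` gives a countable intersection, whereas exact agreement
would give an uncontrolled union of closed sets. -/
theorem measurableSet_collisionSet {N : ℕ} {X : Set (EuclideanSpace ℝ (Fin N))}
    (𝓑 : BoundedBasis N) (k : ℕ) (T : X → X) (U V : Set X) (M : ℝ) (P : Set (X × X)) :
    MeasurableSet[borel (LipLoc X 𝓑)] (collisionSet 𝓑 k T U V M P) := by
  borelize (LipLoc X 𝓑)
  have hcont : ∀ (i : ℕ) (x y : X),
      Continuous fun h : LipLoc X 𝓑 => |h (T^[i] x) - h (T^[i] y)| := fun i x y =>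
    ((LipLoc.continuous_eval _).sub (LipLoc.continuous_eval _)).abs
  have hlip : ∀ W : Set X, IsClosed {h : LipLoc X 𝓑 |
      ∀ i < k, ∀ x ∈ W, ∀ y ∈ W, |h (T^[i] x) - h (T^[i] y)| ≤ M * dist x y} := by
    intro W
    simp only [ofPred_forall]
    exact isClosed_iInter fun i => isClosed_iInter fun _ => isClosed_iInter fun x =>
      isClosed_iInter fun _ => isClosed_iInter fun y => isClosed_iInter fun _ =>
        isClosed_le (hcont i x y) continuous_const
  have hopen : ∀ r : ℝ, IsOpen {h : LipLoc X 𝓑 | ∃ p ∈ P, p.1 ∈ U ∧ p.2 ∈ V ∧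
      ∀ i < k, |h (T^[i] p.1) - h (T^[i] p.2)| < r} := by
    intro r
    simp only [← exists_prop, ofPred_exists]
    refine isOpen_iUnion fun p => isOpen_iUnion fun _ => isOpen_iUnion fun _ =>
      isOpen_iUnion fun _ => ?_
    simp only [ofPred_forall]
    exact (finite_lt_nat k).isOpen_biInter fun i _ => isOpen_lt (hcont i _ _) continuous_const
  have hall : MeasurableSet {h : LipLoc X 𝓑 | ∀ m : ℕ, ∃ p ∈ P, p.1 ∈ U ∧ p.2 ∈ V ∧
      ∀ i < k, |h (T^[i] p.1) - h (T^[i] p.2)| < 1 / ((m : ℝ) + 1)} := by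
    rw [ofPred_forall]
    exact MeasurableSet.iInter fun m => (hopen _).measurableSet
  exact (hlip U).measurableSet.inter ((hlip V).measurableSet.inter hall)

/-- Almost no polynomial perturbation of a given function has a collision. -/
theorem volume_collisionSet_eq_zero {N : ℕ} {X : Set (EuclideanSpace ℝ (Fin N))}
    (𝓑 : BoundedBasis N) {n k : ℕ} (T : X → X) (U V : Set X) {M : ℝ} (hM : 0 ≤ M) (l : ℝ)
    (hdim : 2 * lowerBoxDimBounded (Subtype.val '' (U ∪ V)) < (k : EReal)) (v : LipLoc X 𝓑) :
    volume {a : (Fin n → Option (Fin N)) → ℝ | a ∈ Metric.closedBall 0 1 ∧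
      v + LipLoc.ofWordPoly X 𝓑 a ∈ collisionSet 𝓑 k T U V M (separablePairs n k T l)} = 0 := by
  set B := volume (Metric.closedBall (0 : (Fin n → Option (Fin N)) → ℝ) (1 + l)) with hB
  set K : ℝ≥0∞ := B * ENNReal.ofReal ((2 * (1 + 2 * M)) ^ k) with hK
  have hKtop : K ≠ ⊤ :=
    ENNReal.mul_ne_top Metric.isBounded_closedBall.measure_lt_top.ne ENNReal.ofReal_ne_top
  suffices H : ∀ ε : ℝ, 0 < ε → volume {a : (Fin n → Option (Fin N)) → ℝ |
      a ∈ Metric.closedBall 0 1 ∧ v + LipLoc.ofWordPoly X 𝓑 a ∈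
        collisionSet 𝓑 k T U V M (separablePairs n k T l)} ≤ ENNReal.ofReal ε * K by
    have hlim : Tendsto (fun ε : ℝ => ENNReal.ofReal ε * K) (𝓝[>] 0) (𝓝 0) := by
      have h1 : Tendsto (fun ε : ℝ => ENNReal.ofReal ε) (𝓝[>] 0) (𝓝 0) := by
        have := ENNReal.continuous_ofReal.tendsto 0
        rw [ENNReal.ofReal_zero] at this
        exact this.mono_left nhdsWithin_le_nhds
      have h2 := ENNReal.Tendsto.mul_const (b := K) h1 (Or.inr hKtop)
      rwa [zero_mul] at h2
    exact nonpos_iff_eq_zero.1 (ge_of_tendsto hlim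
      (eventually_nhdsWithin_of_forall fun ε hε => H ε hε))
  intro ε hε
  -- One cover of the union serves both points of a pair, so the same good scale `δ` is available
  -- for both.
  obtain ⟨δ, C, hδ, hCδ, hC⟩ := exists_cover_of_dim_lt hdim hε
  -- A collision within `δ`, plus `M * δ` for moving each of the two points inside its ball.
  set η : ℝ := (1 + 2 * M) * δ with hη
  have hη0 : 0 ≤ η := by positivity
  set G : EuclideanSpace ℝ (Fin N) × EuclideanSpace ℝ (Fin N) → X × X → Prop := fun q p =>
    p ∈ separablePairs n k T l ∧ p.1 ∈ U ∧ p.2 ∈ V ∧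
      dist (p.1 : EuclideanSpace ℝ (Fin N)) q.1 ≤ δ / 2 ∧
      dist (p.2 : EuclideanSpace ℝ (Fin N)) q.2 ≤ δ / 2 with hG
  -- Quantifying over all `p'` lets a single separable pair, chosen independently of `a`, bound the
  -- whole set by one slab.
  set S : EuclideanSpace ℝ (Fin N) × EuclideanSpace ℝ (Fin N) →
      Set ((Fin n → Option (Fin N)) → ℝ) := fun q =>
    {a | a ∈ Metric.closedBall 0 1 ∧ ∃ p, G q p ∧ ∀ p', G q p' → ∀ i < k,
      |(v + LipLoc.ofWordPoly X 𝓑 a) (T^[i] p'.1) - (v + LipLoc.ofWordPoly X 𝓑 a) (T^[i] p'.2)|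
        ≤ η} with hS
  have hsub : {a : (Fin n → Option (Fin N)) → ℝ | a ∈ Metric.closedBall 0 1 ∧
      v + LipLoc.ofWordPoly X 𝓑 a ∈ collisionSet 𝓑 k T U V M (separablePairs n k T l)} ⊆
      ⋃ q ∈ C ×ˢ C, S q := by
    rintro a ⟨ha, hU, hV, hcol⟩
    obtain ⟨m, hm⟩ := exists_nat_one_div_lt hδ
    obtain ⟨p, hpP, hpU, hpV, hp⟩ := hcol m
    obtain ⟨c, hc, hpc⟩ := hC p.1 ⟨p.1, Or.inl hpU, rfl⟩
    obtain ⟨c', hc', hpc'⟩ := hC p.2 ⟨p.2, Or.inr hpV, rfl⟩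
    refine mem_iUnion₂.2 ⟨(c, c'), Finset.mem_product.2 ⟨hc, hc'⟩, ha, p,
      ⟨hpP, hpU, hpV, hpc, hpc'⟩, ?_⟩
    rintro p' ⟨-, hpU', hpV', hd, hd'⟩ i hi
    have e1 : dist p'.1 p.1 ≤ δ := by
      refine (dist_triangle_right (p'.1 : EuclideanSpace ℝ (Fin N)) p.1 c).trans ?_
      simp only at hd hpc
      linarith
    have e2 : dist p.2 p'.2 ≤ δ := by
      refine (dist_triangle_right (p.2 : EuclideanSpace ℝ (Fin N)) p'.2 c').trans ?_
      simp only at hd' hpc'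
      linarith
    have f1 := (hU i hi _ hpU' _ hpU).trans (mul_le_mul_of_nonneg_left e1 hM)
    have f2 := (hV i hi _ hpV _ hpV').trans (mul_le_mul_of_nonneg_left e2 hM)
    have f3 := hp i hi
    rw [abs_le] at f1 f2 ⊢
    rw [abs_lt] at f3
    rw [hη]
    constructor <;> nlinarith [f1.1, f1.2, f2.1, f2.2, f3.1, f3.2]
  have hSq : ∀ q, volume (S q) ≤ B * ENNReal.ofReal ((2 * η) ^ k) := by
    intro q
    rcases (S q).eq_empty_or_nonempty with h0 | ⟨_, -, p, hp, -⟩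
    · rw [h0, measure_empty]; exact zero_le
    obtain ⟨A, hA, hAl⟩ := hp.1
    have := volume_slab_le _ A hA hAl (fun i => v (T^[i] p.1) - v (T^[i] p.2)) hη0
    rw [Fintype.card_fin] at this
    refine le_trans (measure_mono ?_) this
    rintro a ⟨ha, -, -, hall⟩
    refine ⟨ha, (pi_norm_le_iff_of_nonneg hη0).2 fun i => ?_⟩
    have h1 := hall p hp i i.2
    rw [LipLoc.add_apply, LipLoc.add_apply, add_sub_add_comm] at h1
    exact h1
  calc _ ≤ volume (⋃ q ∈ C ×ˢ C, S q) := measure_mono hsub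
    _ ≤ ∑ q ∈ C ×ˢ C, volume (S q) := measure_biUnion_finset_le _ _
    _ ≤ ∑ q ∈ C ×ˢ C, B * ENNReal.ofReal ((2 * η) ^ k) := Finset.sum_le_sum fun q _ => hSq q
    _ = ENNReal.ofReal ((C.card : ℝ) ^ 2 * δ ^ k) * K := by
        rw [Finset.sum_const, Finset.card_product, nsmul_eq_mul, hK, hη,
          ENNReal.ofReal_mul (by positivity), ENNReal.ofReal_pow (by positivity) 2,
          ENNReal.ofReal_natCast, ← mul_assoc 2, mul_pow _ δ, ENNReal.ofReal_mul (by positivity)]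
        push_cast
        ring
    _ ≤ ENNReal.ofReal ε * K := mul_le_mul_left (ENNReal.ofReal_le_ofReal hCδ) _

/-- This reduces local Lipschitz behaviour to countably many data. Allowing every `M ≥ m` lets two
points share one constant. -/
theorem exists_lipschitz_basis_nhd {N : ℕ} {X : Set (EuclideanSpace ℝ (Fin N))}
    (𝓑 : BoundedBasis N) (k : ℕ) {T : X → X} (hT : LocallyLipschitz T) {h : X → ℝ}
    (hh : LocallyLipschitz h) (x : X) :
    ∃ n m : ℕ, (x : EuclideanSpace ℝ (Fin N)) ∈ 𝓑.U n ∧ ∀ M : ℕ, m ≤ M →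
      ∀ i < k, ∀ y ∈ ((↑) ⁻¹' 𝓑.U n : Set X), ∀ z ∈ ((↑) ⁻¹' 𝓑.U n : Set X),
        |h (T^[i] y) - h (T^[i] z)| ≤ M * dist y z := by
  choose L t ht hL using fun i : Fin k => (hh.comp (hT.iterate i)) x
  obtain ⟨O, hO, hOt⟩ := mem_nhds_subtype _ _ _ |>.1 (Filter.iInter_mem.2 ht)
  obtain ⟨_, ⟨n, rfl⟩, hxn, hnO⟩ := 𝓑.isBasis.mem_nhds_iff.1 hO
  obtain ⟨m, hm⟩ := exists_nat_ge (Finset.univ.sup L)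
  refine ⟨n, m, hxn, fun M hM i hi y hy z hz => ?_⟩
  have hsub : ∀ {w : X}, w ∈ ((↑) ⁻¹' 𝓑.U n : Set X) → w ∈ t ⟨i, hi⟩ := fun {w} hw =>
    mem_iInter.1 (hOt (hnO hw)) ⟨i, hi⟩
  have h1 := (hL ⟨i, hi⟩).dist_le_mul y (hsub hy) z (hsub hz)
  rw [Real.dist_eq] at h1
  refine h1.trans (mul_le_mul_of_nonneg_right ?_ dist_nonneg)
  have h2 : L ⟨i, hi⟩ ≤ (M : ℝ≥0) :=
    (Finset.le_sup (Finset.mem_univ _)).trans (hm.trans (Nat.cast_le.2 hM))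
  exact_mod_cast h2

/-! ### Prevalence. -/

theorem isPrevalent_nextValueDetermined {N : ℕ} (𝓑 : BoundedBasis N)
    {X : Set (EuclideanSpace ℝ (Fin N))} {T : X → X} (hT : LocallyLipschitz T) {k : ℕ}
    (hk : 2 * lowerBoxDim X < (k : EReal)) :
    IsPrevalent {h : LipLoc X 𝓑 | NextValueDetermined k T h} := by
  borelize (LipLoc X 𝓑)
  set E : Set (LipLoc X 𝓑) := ⋃ (n : ℕ) (n' : ℕ) (M : ℕ) (l : ℕ),
    collisionSet 𝓑 k T ((↑) ⁻¹' 𝓑.U n) ((↑) ⁻¹' 𝓑.U n') M (separablePairs (k + k) k T l) with hE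
  have hEm : MeasurableSet E := MeasurableSet.iUnion fun n => MeasurableSet.iUnion fun n' =>
    MeasurableSet.iUnion fun M => MeasurableSet.iUnion fun l =>
      measurableSet_collisionSet 𝓑 k T _ _ _ _
  have hΛ : Continuous fun a : (Fin (k + k) → Option (Fin N)) → ℝ => LipLoc.ofWordPoly X 𝓑 a :=
    LipLoc.continuous_ofWordPoly _
  have hball : MeasurableSet
      (Metric.closedBall (0 : (Fin (k + k) → Option (Fin N)) → ℝ) 1) :=
    Metric.isClosed_closedBall.measurableSet
  refine ⟨Eᶜ, fun h hh x y hxy => ?_, hEm.compl,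
    (volume.restrict (Metric.closedBall 0 1)).map
      fun a : (Fin (k + k) → Option (Fin N)) → ℝ => LipLoc.ofWordPoly X 𝓑 a,
    ⟨_, (isCompact_closedBall 0 1).image hΛ, ?_, ?_⟩, fun v => ?_⟩
  · by_contra hne
    refine hh ?_
    obtain ⟨n, m, hxn, hn⟩ := exists_lipschitz_basis_nhd 𝓑 k hT h.locallyLipschitz x
    obtain ⟨n', m', hyn, hn'⟩ := exists_lipschitz_basis_nhd 𝓑 k hT h.locallyLipschitz y
    obtain ⟨l, hl⟩ := exists_mem_separablePairs hxy hne
    refine mem_iUnion.2 ⟨n, mem_iUnion.2 ⟨n', mem_iUnion.2 ⟨max m m', mem_iUnion.2 ⟨l,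
      hn _ (le_max_left _ _), hn' _ (le_max_right _ _), fun j => ⟨_, hl, hxn, hyn, ?_⟩⟩⟩⟩⟩
    intro i hi
    simp only [hxy i hi, sub_self, abs_zero]
    positivity
  · rw [Measure.map_apply hΛ.measurable
      ((isCompact_closedBall 0 1).image hΛ).isClosed.measurableSet]
    refine lt_of_lt_of_le ?_ (measure_mono (subset_preimage_image _ _))
    rw [Measure.restrict_apply_self]
    exact Metric.measure_closedBall_pos _ _ one_pos
  · rw [Measure.map_apply hΛ.measurable
      ((isCompact_closedBall 0 1).image hΛ).isClosed.measurableSet]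
    refine lt_of_le_of_lt (measure_mono (subset_univ _)) ?_
    rw [Measure.restrict_apply_univ]
    exact Metric.isBounded_closedBall.measure_lt_top
  · have hvm : MeasurableSet {e : LipLoc X 𝓑 | v + e ∉ Eᶜ} := by
      simp only [mem_compl_iff, not_not]
      exact (LipLoc.continuous_const_add v).measurable hEm
    rw [Measure.map_apply hΛ.measurable hvm, Measure.restrict_apply' hball]
    have hnull : volume (⋃ (n : ℕ) (n' : ℕ) (M : ℕ) (l : ℕ),
        {a : (Fin (k + k) → Option (Fin N)) → ℝ | a ∈ Metric.closedBall 0 1 ∧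
          v + LipLoc.ofWordPoly X 𝓑 a ∈ collisionSet 𝓑 k T ((↑) ⁻¹' 𝓑.U n) ((↑) ⁻¹' 𝓑.U n') M
            (separablePairs (k + k) k T l)}) = 0 := by
      simp only [measure_iUnion_null_iff]
      intro n n' M l
      refine volume_collisionSet_eq_zero 𝓑 T _ _ M.cast_nonneg l (lt_of_le_of_lt ?_ hk) v
      refine mul_le_mul_of_nonneg_left ?_ (by norm_num)
      refine le_iSup_of_le _ (le_iSup_of_le ?_ (le_iSup_of_le ?_ le_rfl))
      · rintro _ ⟨x, -, rfl⟩
        exact x.2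
      · refine ((𝓑.isBounded n).union (𝓑.isBounded n')).subset ?_
        rintro _ ⟨x, hx, rfl⟩
        exact hx
    refine measure_mono_null ?_ hnull
    rintro a ⟨ha, hab⟩
    have ha' := not_not.1 ha
    simp only [hE, mem_iUnion] at ha' ⊢
    obtain ⟨n, n', M, l, h⟩ := ha'
    exact ⟨n, n', M, l, hab, h⟩

theorem IsPrevalent.mono {V : Type*} [AddCommGroup V] [TopologicalSpace V] {S S' : Set V}
    (h : IsPrevalent S) (hS : S ⊆ S') : IsPrevalent S' :=
  let ⟨B, hB, hBm, hν⟩ := h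
  ⟨B, hB.trans hS, hBm, hν⟩

theorem isPrevalent_univ {V : Type*} [AddCommGroup V] [TopologicalSpace V] :
    IsPrevalent (univ : Set V) := by
  borelize V
  refine ⟨univ, subset_rfl, MeasurableSet.univ, Measure.dirac 0,
    ⟨{0}, isCompact_singleton, ?_, ?_⟩, fun v => by simp⟩
  · exact lt_of_lt_of_le (by simp) Measure.le_dirac_apply
  · exact lt_of_le_of_lt prob_le_one ENNReal.one_lt_top

end

theorem theorem1p14 (N : ℕ) (𝓑 : BoundedBasis N) (X : Set (EuclideanSpace ℝ (Fin N)))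
    (T : X → X) (hT : LocallyLipschitz T) :
    IsPrevalent {h : LipLoc X 𝓑 | ∀ k : ℕ, 2 * lowerBoxDim X < (k : EReal) →
      IsDetPredictable k T h ∧
      ∃ S : range (delayMap k T h) → range (delayMap k T h),
        IsPredictionMap k T h S ∧ (IsCompact X → Continuous S)} := by
  classical
  by_cases hex : ∃ k : ℕ, 2 * lowerBoxDim X < (k : EReal)
  -- The least admissible `k` settles all others by monotonicity, so no intersection of prevalent
  -- sets is required.
  · refine (isPrevalent_nextValueDetermined 𝓑 hT (Nat.find_spec hex)).mono fun h hh k hk => ?_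
    have H := (NextValueDetermined.mono (Nat.find_min' hex hk) hh).isDetPredictable
    obtain ⟨S, hS, hSc⟩ := H.exists_isPredictionMap hT.continuous h.locallyLipschitz.continuous
    exact ⟨H, S, hS, fun hX => hSc (isCompact_iff_compactSpace.1 hX)⟩
  · exact isPrevalent_univ.mono fun h _ k hk => absurd ⟨k, hk⟩ hex
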